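/- Let $a=0.16$, $a'=1.2$, $a''=0.14927$. For real $h\ge 0$ and $n>0$ put $\Phi_h(n)=1$ if $n<h/2$, $$\Phi_h(n)=a\,\frac{\log\frac{2n}{h}+1}{\frac nh-a''}\left(\sqrt{1+\frac{a'\left(\frac nh-a''\right)}{\log\frac{2n}{h}+1}}+1\right)\quad\text{if } 0<h\le 2n,$$ and $\Phi_0(n)=0$ (the limit as $h\downarrow 0$). Let $k,m\ge 1$ be integers, let $n_1,\dots,n_k\ge 1$ be integers (the design points), and let $0\le h^*\le M$ be real. Let $\hat\xi_i(n_\ell)$, $1\le \ell\le k$, $1\le i\le m$, be independent random variables with values in $[0,1]$ and mean $\mathbb E[\hat\xi_i(n_\ell)]=\Phi_{h^*}(n_\ell)$, and put $\hat\xi(n_\ell)=\frac1m\sum_{i=1}^m\hat\xi_i(n_\ell)$. Write $\|g\|_k^2=\frac1k\sum_{\ell=1}^k g(n_\ell)^2$, and let $\hat h$ be a least-squares estimate of $h^*$, that is, a minimizer of $h\mapsto\|\hat\xi-\Phi_h\|_k$ over $h\in[0,M]$. (If no minimizer exists for some outcomes, the event below is restricted to the outcomes for which $\hat h$ is a minimizer.)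 Let $L(n_1),\dots,L(n_k)$ be any real numbers (for instance Lipschitz constants of $h\mapsto\Phi_h(n_\ell)$ on a range of $h$ where these exist), and put $c'=\frac1k\sum_{\ell=1}^k L(n_\ell)^2$, $c_3=2304$ and $$c_1=\left(c'+\tfrac14\right)\sqrt{\log(4c'+1)}-\frac{\sqrt\pi}{8}\,\mathrm{erfi}\left(\sqrt{4c'+1}\right),\qquad \mathrm{erfi}(x)=\frac{2}{\sqrt\pi}\int_0^x e^{t^2}\,dt .$$ Then for every $$\delta>\frac{4}{\sqrt{2mk}}\max\{24c_1,29\}$$ we have $$\mathbb P\left(\|\Phi_{\hat h}-\Phi_{h^*}\|_k>\delta\right)\le 13\exp\left\{-\frac{mk\delta^2}{16c_3}\right\}.$$ -/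

import Mathlib

namespace VCEst

/-- The curve `Φ_h(n)` with `a = 0.16`, `a' = 1.2`, `a'' = 0.14927`. At `h = 0` (where the formula
divides by `h`) the value is the limit `0` of the formula as `h ↓ 0` with `n > 0` fixed. -/
noncomputable def Phi (h n : ℝ) : ℝ :=
  if n < h / 2 then 1
  else if h = 0 then 0
  else
    0.16 * ((Real.log (2 * n / h) + 1) / (n / h - 0.14927)) *
      (Real.sqrt (1 + 1.2 * (n / h - 0.14927) / (Real.log (2 * n / h) + 1)) + 1)

/-- The empirical norm `‖g‖_k`, for `g` given by its values at the `k` design points. -/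
noncomputable def empNorm {k : ℕ} (g : Fin k → ℝ) : ℝ :=
  Real.sqrt ((1 / (k : ℝ)) * ∑ l, g l ^ 2)

/-- The averaged observation at each design point: the mean of its `m` replications. -/
noncomputable def xiHat {k m : ℕ} (ξ : Fin k → Fin m → ℝ) (l : Fin k) : ℝ :=
  (1 / (m : ℝ)) * ∑ i, ξ l i

/-- `h` is a least-squares estimate on `[0, M]`: a minimizer over `[0, M]` of
`h' ↦ ‖y - Φ_{h'}‖_k`, where `y` are the averaged observations at the design points `n`. -/
def IsLeastSquares {k : ℕ} (n : Fin k → ℕ) (M : ℝ) (y : Fin k → ℝ) (h : ℝ) : Prop :=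
  h ∈ Set.Icc 0 M ∧
    ∀ h' ∈ Set.Icc 0 M,
      empNorm (fun l => y l - Phi h (n l)) ≤ empNorm (fun l => y l - Phi h' (n l))

/-- The imaginary error function. -/
noncomputable def erfi (x : ℝ) : ℝ :=
  2 / Real.sqrt Real.pi * ∫ t in (0 : ℝ)..x, Real.exp (t ^ 2)

/-- `c' = (1/k) ∑ L(n_l)²`. -/
noncomputable def cPrime {k : ℕ} (L : Fin k → ℝ) : ℝ :=
  (1 / (k : ℝ)) * ∑ l, L l ^ 2

/-- The constant `c₁` as a function of `c'`. -/
noncomputable def c₁ (c' : ℝ) : ℝ :=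
  (c' + 1 / 4) * Real.sqrt (Real.log (4 * c' + 1)) -
    Real.sqrt Real.pi / 8 * erfi (Real.sqrt (4 * c' + 1))

/-- The constant `c₃`. -/
def c₃ : ℝ := 2304

end VCEst

/-! The curves `Phi h` increase with `h` and take values in [0,1], so their values at the design
points form an ordered family in ℝ^k. Along an ordered chain squared distances are superadditive, so
a family of squared diameter D needs at most D/e + 1 balls of squared radius e. This entropy bound
comes from the order alone (`exists_finite_cover`). Put W = ξ̂ - Φ_{h*}. Minimality gives ‖Φ_ĥ -
Φ_{h*}‖² ≤ 2⟨Φ_ĥ - Φ_{h*}, W⟩, and Hoeffding makes linear functionals of W sub-Gaussian. Chaining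
over the covers (`chaining_ordered_family`) bounds the chance that the inner product is that large
somewhere in a given ball; peeling into shells of squared radius growing by 4 then gives the tail.
Only finite unions occur, so neither ĥ nor the supremum over h has to be measurable. -/

namespace VCEst

/-! ### Monotonicity and range of the curve in `h`. -/

/-- The ratio `(r - a'') / (log (2r) + 1)` is nondecreasing on `[1/2, ∞)`. -/
theorem ratio_le_ratio {r s : ℝ} (hr : 1 / 2 ≤ r) (hrs : r ≤ s) :
    (r - 0.14927) / (Real.log (2 * r) + 1) ≤ (s - 0.14927) / (Real.log (2 * s) + 1) := by
  have hr0 : 0 < r := by linarith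
  have hs0 : 0 < s := by linarith
  have hl : 0 ≤ Real.log (2 * r) := Real.log_nonneg (by linarith)
  have hl' : 0 ≤ Real.log (2 * s) := Real.log_nonneg (by linarith)
  -- The tangent line of the concave logarithm at `r` bounds the growth of the denominator.
  have hlog : Real.log (2 * s) ≤ Real.log (2 * r) + (s - r) / r := by
    have h1 := Real.log_le_sub_one_of_pos (div_pos hs0 hr0)
    have h2 : Real.log (2 * s) = Real.log (2 * r) + Real.log (s / r) := by
      rw [← Real.log_mul (by positivity) (by positivity)]
      congr 1
      field_simp
    have h3 : (s - r) / r = s / r - 1 := by field_simp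
    linarith
  rw [div_le_div_iff₀ (by linarith) (by linarith)]
  have h4 : (r - 0.14927) * ((s - r) / r) ≤ s - r := by
    rw [mul_div_assoc', div_le_iff₀ hr0]
    nlinarith
  nlinarith [mul_le_mul_of_nonneg_left hlog (show 0 ≤ r - 0.14927 by linarith)]

/-- The curve as a function of the ratio `u = (n/h - a'') / (log (2n/h) + 1)`. -/
noncomputable def ratioCurve (u : ℝ) : ℝ :=
  0.16 * u⁻¹ * (Real.sqrt (1 + 1.2 * u) + 1)

theorem ratioCurve_nonneg {u : ℝ} (hu : 0 < u) : 0 ≤ ratioCurve u := by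
  unfold ratioCurve
  positivity

/-- In x = 1/u the curve is 0.16(√(x² + 1.2x) + x), visibly increasing in x. -/
theorem ratioCurve_anti {u v : ℝ} (hu : 0 < u) (huv : u ≤ v) : ratioCurve v ≤ ratioCurve u := by
  have key : ∀ {w : ℝ}, 0 < w →
      ratioCurve w = 0.16 * (Real.sqrt ((w⁻¹) ^ 2 + 1.2 * w⁻¹) + w⁻¹) := by
    intro w hw
    have : (w⁻¹) ^ 2 + 1.2 * w⁻¹ = (w⁻¹) ^ 2 * (1 + 1.2 * w) := by
      field_simp
    rw [this, Real.sqrt_mul (by positivity), Real.sqrt_sq (by positivity), ratioCurve]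
    ring
  have hinv : v⁻¹ ≤ u⁻¹ := inv_anti₀ hu huv
  have hv : 0 < v := hu.trans_le huv
  rw [key hu, key hv]
  gcongr

/-- The value 0.35073 = 1/2 - 0.14927 is the ratio at n/h = 1/2, where the formula gives way to the
constant 1; monotonicity survives because the formula does not exceed 1 there. -/
theorem ratioCurve_le_one : ratioCurve 0.35073 ≤ 1 := by
  have : Real.sqrt (1 + 1.2 * 0.35073) ≤ 1.19201 := by
    rw [Real.sqrt_le_left (by norm_num)]
    norm_num
  unfold ratioCurve
  have h2 : (0.16 : ℝ) * (0.35073)⁻¹ * (Real.sqrt (1 + 1.2 * 0.35073) + 1)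
      ≤ 0.16 * (0.35073)⁻¹ * (1.19201 + 1) := by gcongr
  refine h2.trans ?_
  norm_num

theorem ratio_half_le {r : ℝ} (hr : 1 / 2 ≤ r) :
    0.35073 ≤ (r - 0.14927) / (Real.log (2 * r) + 1) := by
  have := ratio_le_ratio le_rfl hr
  norm_num at this ⊢
  exact this

theorem Phi_eq_ratioCurve {h n : ℝ} (hh : 0 < h) (hn : h / 2 ≤ n) :
    Phi h n = ratioCurve ((n / h - 0.14927) / (Real.log (2 * (n / h)) + 1)) := by
  rw [Phi, if_neg (not_lt.mpr hn), if_neg hh.ne', ratioCurve, inv_div, mul_div_assoc 2 n h,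
    mul_div_assoc (1.2 : ℝ)]

theorem half_le_div {h n : ℝ} (hh : 0 < h) (hn : h / 2 ≤ n) : 1 / 2 ≤ n / h := by
  rw [le_div_iff₀ hh]
  linarith

theorem Phi_mono {n : ℝ} (hn : 0 < n) : MonotoneOn (fun h => Phi h n) (Set.Ici 0) := by
  intro h hh h' hh' hle
  simp only [Set.mem_Ici] at hh hh'
  change Phi h n ≤ Phi h' n
  by_cases h1 : n < h / 2
  · have h2 : n < h' / 2 := by linarith
    simp [Phi, h1, h2]
  push Not at h1
  rcases hh.eq_or_lt with h0 | h0
  · subst h0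
    have hz : Phi 0 n = 0 := by simp [Phi, hn.le]
    rw [hz]
    by_cases h2 : n < h' / 2
    · simp [Phi, h2]
    push Not at h2
    rcases hh'.eq_or_lt with h3 | h3
    · rw [← h3, hz]
    rw [Phi_eq_ratioCurve h3 h2]
    exact ratioCurve_nonneg (lt_of_lt_of_le (by norm_num) (ratio_half_le (half_le_div h3 h2)))
  rw [Phi_eq_ratioCurve h0 h1]
  have hu := ratio_half_le (half_le_div h0 h1)
  by_cases h2 : n < h' / 2
  · have : Phi h' n = 1 := by simp [Phi, h2]
    rw [this]
    exact (ratioCurve_anti (by norm_num) hu).trans ratioCurve_le_one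
  push Not at h2
  have h3 : 0 < h' := h0.trans_le hle
  rw [Phi_eq_ratioCurve h3 h2]
  refine ratioCurve_anti (lt_of_lt_of_le (by norm_num) (ratio_half_le (half_le_div h3 h2)))
    (ratio_le_ratio (half_le_div h3 h2) ?_)
  gcongr

theorem Phi_mem_Icc {h n : ℝ} (hh : 0 ≤ h) (hn : 0 < n) : Phi h n ∈ Set.Icc (0 : ℝ) 1 := by
  constructor
  · have hz : Phi 0 n = 0 := by simp [Phi, hn.le]
    rw [← hz]
    exact Phi_mono hn Set.self_mem_Ici hh hh
  · have hlt : n < (h + 2 * n + 1) / 2 := by linarith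
    have hone : Phi (h + 2 * n + 1) n = 1 := by simp [Phi, hlt]
    rw [← hone]
    exact Phi_mono hn hh (Set.mem_Ici.mpr (by linarith)) (by linarith)

/-! ### Covering numbers of ordered families. -/

section OrderedFamily

variable {ι κ : Type*} [LinearOrder ι] [Fintype κ]

/-- For an ordered family of vectors, squared distances are superadditive along the order. -/
theorem sum_sq_sub_superadd {f : ι → κ → ℝ} {A : Set ι} (hf : MonotoneOn f A) {x y z : ι}
    (hx : x ∈ A) (hy : y ∈ A) (hz : z ∈ A) (hxy : x ≤ y) (hyz : y ≤ z) :
    ∑ l, (f z l - f y l) ^ 2 + ∑ l, (f y l - f x l) ^ 2 ≤ ∑ l, (f z l - f x l) ^ 2 := by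
  rw [← Finset.sum_add_distrib]
  refine Finset.sum_le_sum fun l _ => ?_
  have h1 := hf hx hy hxy l
  have h2 := hf hy hz hyz l
  nlinarith [mul_nonneg (sub_nonneg.mpr h1) (sub_nonneg.mpr h2)]

/-- A separated finite part of an ordered family has small cardinality. -/
theorem separated_card_bound {f : ι → κ → ℝ} {A : Set ι} (hf : MonotoneOn f A) {e : ℝ}
    (T : Finset ι) (hTA : ↑T ⊆ A)
    (hsep : ∀ s ∈ T, ∀ t ∈ T, t < s → e ≤ ∑ l, (f s l - f t l) ^ 2) (hT : T.Nonempty) :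
    ∃ x ∈ T, ∃ y ∈ T, (∀ t ∈ T, y ≤ t) ∧ (∀ t ∈ T, t ≤ x) ∧
      ((T.card : ℝ) - 1) * e ≤ ∑ l, (f x l - f y l) ^ 2 := by
  classical
  induction T using Finset.induction_on_max with
  | empty => exact absurd hT Finset.not_nonempty_empty
  | insert z T hz ih =>
    have hzT : z ∉ T := fun h => lt_irrefl _ (hz z h)
    rcases T.eq_empty_or_nonempty with rfl | hne
    · exact ⟨z, by simp, z, by simp, by simp, by simp, by simp⟩
    · obtain ⟨x, hx, y, hy, hy', hx', hb⟩ := ih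
        (fun t ht => hTA (by simp [Finset.mem_coe.mp ht]))
        (fun s hs t ht => hsep s (Finset.mem_insert_of_mem hs) t (Finset.mem_insert_of_mem ht)) hne
      refine ⟨z, by simp, y, by simp [hy], ?_, ?_, ?_⟩
      · intro t ht
        rcases Finset.mem_insert.mp ht with rfl | ht
        · exact (hz y hy).le
        · exact hy' t ht
      · intro t ht
        rcases Finset.mem_insert.mp ht with rfl | ht
        · exact le_rfl
        · exact (hz t ht).le
      -- The new maximum `z` lies at squared distance at least `e` from the old one, and
      -- superadditivity adds this gap to the span.
      · have h1 := sum_sq_sub_superadd hf (hTA (by simp [hy] : y ∈ _))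
          (hTA (by simp [hx] : x ∈ _)) (hTA (by simp : z ∈ _)) (hy' x hx) (hz x hx).le
        have h2 := hsep z (by simp) x (by simp [hx]) (hz x hx)
        rw [Finset.card_insert_of_notMem hzT]
        push_cast
        linarith

/-- An ordered family of squared diameter at most `D` is covered by at most `D / e + 1` balls of
squared radius `e`. -/
theorem exists_finite_cover {f : ι → κ → ℝ} {A : Set ι} (hf : MonotoneOn f A) {D e : ℝ}
    (hD : ∀ s ∈ A, ∀ t ∈ A, ∑ l, (f s l - f t l) ^ 2 ≤ D) (he : 0 < e) (hD0 : 0 ≤ D) :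
    ∃ T : Finset ι, ↑T ⊆ A ∧ (T.card : ℝ) ≤ D / e + 1 ∧
      ∀ h ∈ A, ∃ t ∈ T, ∑ l, (f h l - f t l) ^ 2 ≤ e := by
  classical
  by_contra hcon
  push Not at hcon
  have hcard : ∀ T : Finset ι, ↑T ⊆ A →
      (∀ s ∈ T, ∀ t ∈ T, t < s → e ≤ ∑ l, (f s l - f t l) ^ 2) → (T.card : ℝ) ≤ D / e + 1 := by
    intro T hTA hsep
    rcases T.eq_empty_or_nonempty with rfl | hne
    · simp only [Finset.card_empty, Nat.cast_zero]
      positivity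
    · obtain ⟨x, hx, y, hy, -, -, hb⟩ := separated_card_bound hf T hTA hsep hne
      have := hb.trans (hD x (hTA hx) y (hTA hy))
      rw [← le_div_iff₀ he] at this
      linarith
  -- If no set of the allowed size covers, every separated set can be enlarged by an uncovered
  -- point, giving separated sets of every size.
  have hex : ∀ N : ℕ, ∃ T : Finset ι, ↑T ⊆ A ∧
      (∀ s ∈ T, ∀ t ∈ T, t < s → e ≤ ∑ l, (f s l - f t l) ^ 2) ∧ T.card = N := by
    intro N
    induction N with
    | zero => exact ⟨∅, by simp, by simp, rfl⟩
    | succ N ih =>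
      obtain ⟨T, hTA, hsep, hN⟩ := ih
      obtain ⟨h, hA, hfar⟩ := hcon T hTA (hcard T hTA hsep)
      have hfar' : ∀ t ∈ T, e < ∑ l, (f t l - f h l) ^ 2 := by
        intro t ht
        refine (hfar t ht).trans_eq (Finset.sum_congr rfl fun l _ => by ring)
      have hnot : h ∉ T := by
        intro hh
        have := hfar h hh
        simp only [sub_self] at this
        norm_num at this
        linarith
      refine ⟨insert h T, ?_, ?_, by rw [Finset.card_insert_of_notMem hnot, hN]⟩
      · intro t ht
        rcases Finset.mem_insert.mp (Finset.mem_coe.mp ht) with rfl | ht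
        · exact hA
        · exact hTA ht
      · intro s hs t ht hlt
        rcases Finset.mem_insert.mp hs with hs | hs <;> rcases Finset.mem_insert.mp ht with ht | ht
        · exact absurd (ht.trans hs.symm) hlt.ne
        · rw [hs]; exact (hfar t ht).le
        · rw [ht]; exact (hfar' s hs).le
        · exact hsep s hs t ht hlt
  obtain ⟨N, hN⟩ := exists_nat_gt (D / e + 1)
  obtain ⟨T, hTA, hsep, hcN⟩ := hex N
  have := hcard T hTA hsep
  rw [hcN] at this
  linarith

end OrderedFamily
open MeasureTheory ProbabilityTheory

/-! ### Hoeffding bound and chaining. -/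

section Deviation

variable {Ω : Type*} [MeasurableSpace Ω] {μ : Measure Ω}

/-- Hoeffding's inequality for linear combinations of averaged `[0,1]`-valued observations. -/
theorem measure_linear_xiHat_le [IsProbabilityMeasure μ] {k m : ℕ} (hm : 0 < m)
    {ξ : Fin k → Fin m → Ω → ℝ} {p : Fin k → ℝ}
    (hξ_meas : ∀ l i, Measurable (ξ l i))
    (hξ_indep : iIndepFun (fun q : Fin k × Fin m => ξ q.1 q.2) μ)
    (hξ_range : ∀ l i, ∀ᵐ ω ∂μ, ξ l i ω ∈ Set.Icc (0 : ℝ) 1)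
    (hξ_mean : ∀ l i, ∫ ω, ξ l i ω ∂μ = p l)
    (c : Fin k → ℝ) {v r : ℝ} (hv : 0 < v) (hc : ∑ l, c l ^ 2 ≤ r) :
    μ.real {ω | v ≤ ∑ l, c l * (xiHat (fun l i => ξ l i ω) l - p l)} ≤
      Real.exp (-(2 * m * v ^ 2 / r)) := by
  have hm' : (0 : ℝ) < m := by exact_mod_cast hm
  have hsub : ∀ q ∈ (Finset.univ : Finset (Fin k × Fin m)),
      HasSubgaussianMGF (fun ω => c q.1 * (ξ q.1 q.2 ω - p q.1))
        (‖c q.1‖₊ ^ 2 / 4) μ := by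
    intro q _
    have h := hasSubgaussianMGF_of_mem_Icc (hξ_meas q.1 q.2).aemeasurable (hξ_range q.1 q.2)
    rw [hξ_mean] at h
    convert h.const_mul (c q.1) using 1
    apply NNReal.coe_injective
    change ‖c q.1‖ ^ 2 / 4 = c q.1 ^ 2 * (‖(1 : ℝ) - 0‖ / 2) ^ 2
    norm_num
    ring
  have hind : iIndepFun (fun (q : Fin k × Fin m) ω => c q.1 * (ξ q.1 q.2 ω - p q.1)) μ :=
    hξ_indep.comp (fun q x => c q.1 * (x - p q.1)) (fun q => by fun_prop)
  have hH := HasSubgaussianMGF.measure_sum_ge_le_of_iIndepFun hind hsub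
    (ε := m * v) (by positivity)
  have hset : {ω | v ≤ ∑ l, c l * (xiHat (fun l i => ξ l i ω) l - p l)} =
      {ω | m * v ≤ ∑ q : Fin k × Fin m, c q.1 * (ξ q.1 q.2 ω - p q.1)} := by
    ext ω
    have : ∑ q : Fin k × Fin m, c q.1 * (ξ q.1 q.2 ω - p q.1) =
        m * ∑ l, c l * (xiHat (fun l i => ξ l i ω) l - p l) := by
      rw [Fintype.sum_prod_type, Finset.mul_sum]
      refine Finset.sum_congr rfl fun l _ => ?_
      simp only [xiHat]
      rw [← Finset.mul_sum, Finset.sum_sub_distrib]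
      simp only [Finset.sum_const, Finset.card_univ, Fintype.card_fin, nsmul_eq_mul]
      field_simp
    simp only [Set.mem_ofPred_eq, this]
    exact (mul_le_mul_iff_right₀ hm').symm
  rw [hset]
  have hparam : ((∑ q : Fin k × Fin m, ‖c q.1‖₊ ^ 2 / 4 : NNReal) : ℝ) =
      m * (∑ l, c l ^ 2) / 4 := by
    push_cast
    rw [Fintype.sum_prod_type, Finset.mul_sum, Finset.sum_div]
    refine Finset.sum_congr rfl fun l _ => ?_
    simp only [Finset.sum_const, Finset.card_univ, Fintype.card_fin, nsmul_eq_mul,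
      Real.norm_eq_abs, sq_abs]
    ring
  -- For c = 0 the Hoeffding exponent divides by zero and is useless, but the event is empty since v
  -- > 0.
  rcases (Finset.sum_nonneg fun l _ => sq_nonneg (c l) :
      (0 : ℝ) ≤ ∑ l, c l ^ 2).eq_or_lt with h0 | h0
  · have hc0 : ∀ l, c l = 0 := by
      intro l
      have := (Finset.sum_eq_zero_iff_of_nonneg fun l _ => sq_nonneg (c l)).mp h0.symm l
        (Finset.mem_univ _)
      exact pow_eq_zero_iff two_ne_zero |>.mp this
    have hemp : {ω | m * v ≤ ∑ q : Fin k × Fin m, c q.1 * (ξ q.1 q.2 ω - p q.1)} = ∅ := by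
      ext ω
      simp only [hc0, zero_mul, Finset.sum_const_zero, Set.mem_ofPred_eq, Set.mem_empty_iff_false,
        iff_false, not_le]
      positivity
    rw [hemp, measureReal_empty]
    positivity
  · refine hH.trans (Real.exp_le_exp.mpr ?_)
    have hle : 2 * m * v ^ 2 / r ≤ 2 * m * v ^ 2 / ∑ l, c l ^ 2 := by gcongr
    rw [hparam]
    have heq : -(m * v) ^ 2 / (2 * (m * (∑ l, c l ^ 2) / 4)) =
        -(2 * m * v ^ 2 / ∑ l, c l ^ 2) := by
      field_simp
      ring
    rw [heq]
    exact neg_le_neg hle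

theorem exp_neg_three_le : Real.exp (-3) ≤ 1 / 8 := by
  rw [Real.exp_neg, ← one_div]
  refine one_div_le_one_div_of_le (by norm_num) ?_
  have : Real.exp 3 = Real.exp 1 ^ 3 := by rw [← Real.exp_nat_mul]; norm_num
  rw [this]
  have h4 : (2 : ℝ) ≤ Real.exp 1 := by linarith [Real.exp_one_gt_d9]
  calc (8 : ℝ) = 2 ^ 3 := by norm_num
    _ ≤ _ := by gcongr

/-- Bernoulli gives (9/4)^s ≥ 1 + s, so each level gains a factor e^{-3} ≤ 1/8 against the 4 from
the cover. -/
theorem pow_mul_exp_le {z : ℝ} (hz : 3 ≤ z) (s : ℕ) :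
    4 ^ s * Real.exp (-(z * (9 / 4) ^ s)) ≤ Real.exp (-z) * (1 / 2) ^ s := by
  have h1 : (1 : ℝ) + s ≤ (9 / 4) ^ s := by
    have := one_add_mul_le_pow (show (-2 : ℝ) ≤ 5 / 4 by norm_num) s
    norm_num at this
    have hs : (0 : ℝ) ≤ s := by positivity
    linarith
  have h2 : -(z * (9 / 4) ^ s) ≤ -z + s * (-3 : ℝ) := by
    have hs : (0 : ℝ) ≤ s := by positivity
    nlinarith [mul_le_mul_of_nonneg_left h1 (show 0 ≤ z by linarith)]
  have h3 := exp_neg_three_le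
  calc 4 ^ s * Real.exp (-(z * (9 / 4) ^ s))
      ≤ 4 ^ s * (Real.exp (-z) * (1 / 8) ^ s) := by
        gcongr
        refine (Real.exp_le_exp.mpr h2).trans ?_
        rw [Real.exp_add, Real.exp_nat_mul]
        gcongr
    _ = Real.exp (-z) * (1 / 2) ^ s := by
        rw [show (1 / 2 : ℝ) = 4 * (1 / 8) by norm_num, mul_pow]
        ring

/-- A chaining bound for linear functionals with sub-Gaussian tails, uniformly over the members of
an ordered family within squared distance `ρ` of a fixed member. -/
theorem chaining_ordered_family [IsProbabilityMeasure μ] {ι κ : Type*} [LinearOrder ι] [Fintype κ]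
    {f : ι → κ → ℝ} {I : Set ι} (hf : MonotoneOn f I) {x₀ : ι}
    {W : Ω → κ → ℝ} {m B ρ : ℝ} (hρ : 0 < ρ)
    (htail : ∀ (c : κ → ℝ) (v r : ℝ), 0 < v → ∑ l, c l ^ 2 ≤ r →
      μ.real {ω | v ≤ ∑ l, c l * W ω l} ≤ Real.exp (-(2 * m * v ^ 2 / r)))
    (hmρ : 3 ≤ 0.0018 * (m * ρ)) :
    μ.real {ω | ∑ l, W ω l ^ 2 ≤ B ∧ ∃ h ∈ I, ∑ l, (f h l - f x₀ l) ^ 2 ≤ ρ ∧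
      ρ / 8 ≤ ∑ l, (f h l - f x₀ l) * W ω l} ≤ 40 * Real.exp (-(0.0018 * (m * ρ))) := by
  classical
  set A : Set ι := {h ∈ I | ∑ l, (f h l - f x₀ l) ^ 2 ≤ ρ} with hA
  have hfA : MonotoneOn f A := hf.mono fun h hh => hh.1
  have hdiam : ∀ s ∈ A, ∀ t ∈ A, ∑ l, (f s l - f t l) ^ 2 ≤ 4 * ρ := by
    intro s hs t ht
    have : ∑ l, (f s l - f t l) ^ 2 ≤
        2 * ∑ l, (f s l - f x₀ l) ^ 2 + 2 * ∑ l, (f t l - f x₀ l) ^ 2 := by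
      rw [Finset.mul_sum, Finset.mul_sum, ← Finset.sum_add_distrib]
      refine Finset.sum_le_sum fun l _ => ?_
      nlinarith [sq_nonneg ((f s l - f x₀ l) + (f t l - f x₀ l))]
    linarith [hs.2, ht.2]
  have hcov : ∀ s : ℕ, ∃ T : Finset ι, ↑T ⊆ A ∧ (T.card : ℝ) ≤ 5 * 4 ^ s ∧
      ∀ h ∈ A, ∃ t ∈ T, ∑ l, (f h l - f t l) ^ 2 ≤ ρ / 4 ^ s := by
    intro s
    obtain ⟨T, h1, h2, h3⟩ := exists_finite_cover hfA hdiam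
      (show 0 < ρ / 4 ^ s by positivity) (by positivity)
    refine ⟨T, h1, h2.trans ?_, h3⟩
    have h4 : 4 * ρ / (ρ / 4 ^ s) = 4 * 4 ^ s := by field_simp
    have h5 : (1 : ℝ) ≤ 4 ^ s := one_le_pow₀ (by norm_num)
    rw [h4]
    linarith
  choose T hTA hTcard hTcov using hcov
  have hpar : ∀ (s : ℕ) (t : ι), ∃ u : ι, t ∈ A →
      ∑ l, (f t l - f u l) ^ 2 ≤ ρ / 4 ^ s ∧ ((s = 0 ∧ u = x₀) ∨ (0 < s ∧ u ∈ T s)) := by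
    intro s t
    by_cases ht : t ∈ A
    · rcases s.eq_zero_or_pos with rfl | hs
      · exact ⟨x₀, fun _ => ⟨by simpa using ht.2, Or.inl ⟨rfl, rfl⟩⟩⟩
      · obtain ⟨u, hu, hu'⟩ := hTcov s t ht
        exact ⟨u, fun _ => ⟨hu', Or.inr ⟨hs, hu⟩⟩⟩
    · exact ⟨x₀, fun h => absurd h ht⟩
  choose parent hparent using hpar
  -- Depth at which Cauchy–Schwarz makes the chain's remainder at most 0.005ρ; 0.000025 = 0.005².
  obtain ⟨S, hS⟩ : ∃ S : ℕ, (1 / 4 : ℝ) ^ S * B ≤ 0.000025 * ρ := by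
    have hlim : Filter.Tendsto (fun S : ℕ => (1 / 4 : ℝ) ^ S * B) Filter.atTop (nhds (0 * B)) :=
      (tendsto_pow_atTop_nhds_zero_of_lt_one (by norm_num) (by norm_num)).mul_const B
    rw [zero_mul] at hlim
    obtain ⟨S, hS⟩ := (hlim.eventually (gt_mem_nhds (show 0 < 0.000025 * ρ by positivity))).exists
    exact ⟨S, hS.le⟩
  -- The thresholds sum to 0.12ρ, and 0.12 + 0.005 = 1/8. With squared link length ρ/4^s the tail
  -- exponent is 2·0.03²·mρ·(9/4)^s, whence 0.0018.
  set link : ℕ → ι → Set Ω := fun s t =>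
    {ω | 0.03 * (3 / 4) ^ s * ρ ≤ ∑ l, (f t l - f (parent s t) l) * W ω l} with hlink
  have hsub : {ω | ∑ l, W ω l ^ 2 ≤ B ∧ ∃ h ∈ I, ∑ l, (f h l - f x₀ l) ^ 2 ≤ ρ ∧
      ρ / 8 ≤ ∑ l, (f h l - f x₀ l) * W ω l} ⊆
      ⋃ s ∈ Finset.range (S + 1), ⋃ t ∈ T (s + 1), link s t := by
    rintro ω ⟨hW, h, hI, hhρ, hbig⟩
    by_contra hnot
    simp only [Set.mem_iUnion, not_exists, Finset.mem_range, hlink, Set.mem_ofPred_eq,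
      not_le] at hnot
    have hhA : h ∈ A := ⟨hI, hhρ⟩
    have hsplit : ∀ a b c : ι, ∑ l, (f a l - f c l) * W ω l =
        ∑ l, (f a l - f b l) * W ω l + ∑ l, (f b l - f c l) * W ω l := by
      intro a b c
      rw [← Finset.sum_add_distrib]
      exact Finset.sum_congr rfl fun l _ => by ring
    have hchain : ∀ s, s < S + 1 → ∀ t ∈ T (s + 1),
        ∑ l, (f t l - f x₀ l) * W ω l < 0.12 * (1 - (3 / 4) ^ (s + 1)) * ρ := by
      intro s
      induction s with
      | zero =>
        intro hs t ht
        have h1 := hnot 0 hs t ht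
        rcases (hparent 0 t (hTA _ ht)).2 with ⟨-, h2⟩ | ⟨h2, -⟩
        · rw [h2] at h1
          refine h1.trans_eq ?_
          norm_num
        · exact absurd h2 (lt_irrefl _)
      | succ s ih =>
        intro hs t ht
        have h1 := hnot (s + 1) hs t ht
        rcases (hparent (s + 1) t (hTA _ ht)).2 with ⟨h2, -⟩ | ⟨-, h2⟩
        · exact absurd h2 (Nat.succ_ne_zero s)
        · have h3 := ih (by omega) _ h2
          rw [hsplit t (parent (s + 1) t) x₀]
          rw [pow_succ _ (s + 1)]
          linarith
    obtain ⟨t, ht, hdist⟩ := hTcov (S + 1) h hhA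
    have h1 := hchain S (Nat.lt_succ_self S) t ht
    have h2 : ∑ l, (f t l - f x₀ l) * W ω l < 0.12 * ρ := by
      have : 0 < (3 / 4 : ℝ) ^ (S + 1) * ρ := by positivity
      linarith
    have h3 : ∑ l, (f h l - f t l) * W ω l ≤ 0.005 * ρ := by
      refine abs_le_of_sq_le_sq' ?_ (by positivity) |>.2
      refine (Finset.sum_mul_sq_le_sq_mul_sq _ _ _).trans ?_
      have h4 : ρ / 4 ^ (S + 1) ≤ ρ * (1 / 4) ^ S := by
        rw [div_eq_mul_inv, one_div, inv_pow]
        gcongr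
        · norm_num
        · omega
      calc (∑ l, (f h l - f t l) ^ 2) * ∑ l, W ω l ^ 2 ≤ (ρ * (1 / 4) ^ S) * B := by
            refine mul_le_mul (hdist.trans h4) hW ?_ (by positivity)
            exact Finset.sum_nonneg fun l _ => sq_nonneg _
        _ = ρ * ((1 / 4) ^ S * B) := by ring
        _ ≤ ρ * (0.000025 * ρ) := by gcongr
        _ = (0.005 * ρ) ^ 2 := by ring
    rw [hsplit h t x₀] at hbig
    linarith
  have hlinkle : ∀ s, ∀ t ∈ T (s + 1),
      μ.real (link s t) ≤ Real.exp (-(0.0018 * (m * ρ) * (9 / 4) ^ s)) := by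
    intro s t ht
    refine (htail _ _ _ (by positivity) (hparent s t (hTA _ ht)).1).trans_eq ?_
    congr 2
    have : (9 / 4 : ℝ) ^ s = ((3 / 4) ^ s) ^ 2 * 4 ^ s := by
      rw [← pow_mul, mul_comm s 2, pow_mul, ← mul_pow]
      norm_num
    rw [this]
    field_simp
    ring
  calc _ ≤ μ.real (⋃ s ∈ Finset.range (S + 1), ⋃ t ∈ T (s + 1), link s t) :=
        measureReal_mono hsub (measure_ne_top _ _)
    _ ≤ ∑ s ∈ Finset.range (S + 1), μ.real (⋃ t ∈ T (s + 1), link s t) :=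
        measureReal_biUnion_finset_le _ _
    _ ≤ ∑ s ∈ Finset.range (S + 1), 20 * Real.exp (-(0.0018 * (m * ρ))) * (1 / 2) ^ s := by
        refine Finset.sum_le_sum fun s _ => ?_
        refine (measureReal_biUnion_finset_le _ _).trans ?_
        refine (Finset.sum_le_sum (hlinkle s)).trans ?_
        rw [Finset.sum_const, nsmul_eq_mul]
        calc _ ≤ 5 * 4 ^ (s + 1) * Real.exp (-(0.0018 * (m * ρ) * (9 / 4) ^ s)) := by
              gcongr
              exact hTcard (s + 1)
          _ = 20 * (4 ^ s * Real.exp (-(0.0018 * (m * ρ) * (9 / 4) ^ s))) := by ring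
          _ ≤ 20 * (Real.exp (-(0.0018 * (m * ρ))) * (1 / 2) ^ s) := by
              gcongr 20 * ?_
              exact pow_mul_exp_le hmρ s
          _ = _ := by ring
    _ ≤ 40 * Real.exp (-(0.0018 * (m * ρ))) := by
        rw [← Finset.mul_sum]
        have := sum_geometric_two_le (S + 1)
        nlinarith [Real.exp_pos (-(0.0018 * (m * ρ)))]

end Deviation

/-! ### Least squares and the size of the sample. -/

theorem empNorm_sq {k : ℕ} (hk : 0 < k) (g : Fin k → ℝ) :
    k * empNorm g ^ 2 = ∑ l, g l ^ 2 := by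
  have hk' : (0 : ℝ) < k := by exact_mod_cast hk
  rw [empNorm, Real.sq_sqrt (mul_nonneg (by positivity)
    (Finset.sum_nonneg fun l _ => sq_nonneg _))]
  field_simp

/-- The basic inequality of least squares. -/
theorem IsLeastSquares.basic_inequality {k : ℕ} (hk : 0 < k) {n : Fin k → ℕ} {M h h₀ : ℝ}
    {y : Fin k → ℝ} (hls : IsLeastSquares n M y h) (h₀_mem : h₀ ∈ Set.Icc 0 M) :
    ∑ l, (Phi h (n l) - Phi h₀ (n l)) ^ 2 ≤
      2 * ∑ l, (Phi h (n l) - Phi h₀ (n l)) * (y l - Phi h₀ (n l)) := by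
  have h1 : k * empNorm (fun l => y l - Phi h (n l)) ^ 2 ≤
      k * empNorm (fun l => y l - Phi h₀ (n l)) ^ 2 := by
    gcongr
    · exact Real.sqrt_nonneg _
    · exact hls.2 h₀ h₀_mem
  rw [empNorm_sq hk, empNorm_sq hk] at h1
  have h2 : ∑ l, (y l - Phi h (n l)) ^ 2 = ∑ l, (y l - Phi h₀ (n l)) ^ 2 +
      ∑ l, (Phi h (n l) - Phi h₀ (n l)) ^ 2 -
      2 * ∑ l, (Phi h (n l) - Phi h₀ (n l)) * (y l - Phi h₀ (n l)) := by
    rw [Finset.mul_sum, ← Finset.sum_add_distrib, ← Finset.sum_sub_distrib]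
    exact Finset.sum_congr rfl fun l _ => by ring
  linarith

theorem xiHat_mem_Icc {k m : ℕ} (hm : 0 < m) {ξ : Fin k → Fin m → ℝ}
    (hξ : ∀ l i, ξ l i ∈ Set.Icc (0 : ℝ) 1) (l : Fin k) : xiHat ξ l ∈ Set.Icc (0 : ℝ) 1 := by
  have hm' : (0 : ℝ) < m := by exact_mod_cast hm
  have h0 : 0 ≤ ∑ i, ξ l i := Finset.sum_nonneg fun i _ => (hξ l i).1
  have h1 : ∑ i, ξ l i ≤ m := by
    refine (Finset.sum_le_sum fun i _ => (hξ l i).2).trans ?_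
    simp
  refine ⟨by unfold xiHat; positivity, ?_⟩
  rw [xiHat, one_div, inv_mul_le_iff₀ hm']
  linarith

theorem sum_sq_sub_le_card {k : ℕ} {x y : Fin k → ℝ} (hx : ∀ l, x l ∈ Set.Icc (0 : ℝ) 1)
    (hy : ∀ l, y l ∈ Set.Icc (0 : ℝ) 1) : ∑ l, (x l - y l) ^ 2 ≤ k := by
  have : ∑ l, (x l - y l) ^ 2 ≤ ∑ _l : Fin k, (1 : ℝ) := by
    refine Finset.sum_le_sum fun l _ => ?_
    rw [sq_le_one_iff_abs_le_one, abs_le]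
    constructor <;> linarith [(hx l).1, (hx l).2, (hy l).1, (hy l).2]
  simpa using this

/-- Here 6728 = (4·29)²/2. -/
theorem sample_size_mul_sq_gt {k m : ℕ} (hk : 0 < k) (hm : 0 < m) {c δ : ℝ}
    (hδ : 4 / Real.sqrt (2 * m * k) * max c 29 < δ) : 0 < δ ∧ 6728 < m * k * δ ^ 2 := by
  have hk' : (0 : ℝ) < k := by exact_mod_cast hk
  have hm' : (0 : ℝ) < m := by exact_mod_cast hm
  have hs : 0 < Real.sqrt (2 * m * k) := Real.sqrt_pos.mpr (by positivity)
  have h1 : 4 / Real.sqrt (2 * m * k) * 29 < δ :=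
    lt_of_le_of_lt (by gcongr; exact le_max_right _ _) hδ
  have hδ0 : 0 < δ := lt_trans (by positivity) h1
  refine ⟨hδ0, ?_⟩
  have h2 : 116 < δ * Real.sqrt (2 * m * k) := by
    rw [div_mul_eq_mul_div, div_lt_iff₀ hs] at h1
    linarith
  have h3 : (116 : ℝ) ^ 2 < (δ * Real.sqrt (2 * m * k)) ^ 2 := by gcongr
  rw [mul_pow, Real.sq_sqrt (by positivity)] at h3
  linarith

end VCEst

/-! ### Peeling and the final bound. -/

open MeasureTheory ProbabilityTheory VCEst in
/-- `ξ l i` is the `i`-th replication at the design point `n l`: independent `[0,1]`-valued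
observations whose mean lies on the true curve `Φ_{h*}`. The numbers `L` entering `c₁` are
arbitrary, so any Lipschitz constants of the curves in the parameter `h` may be taken. The estimate
`hhat` need not be measurable, and least squares need not be solvable for every outcome: the
bounded event is that `hhat` solves the least-squares problem and its curve is far from the true
one. When `hhat` always solves it, this is just the event that the curves are far apart. -/
theorem theorem3
    {Ω : Type*} [MeasurableSpace Ω] (μ : Measure Ω) [IsProbabilityMeasure μ]
    (k m : ℕ) (hk : 0 < k) (hm : 0 < m)
    (n : Fin k → ℕ) (hn : ∀ l, 0 < n l)
    (M hstar : ℝ) (hstar_mem : hstar ∈ Set.Icc 0 M)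
    (ξ : Fin k → Fin m → Ω → ℝ)
    (hξ_meas : ∀ l i, Measurable (ξ l i))
    (hξ_indep : iIndepFun (fun p : Fin k × Fin m => ξ p.1 p.2) μ)
    (hξ_range : ∀ l i, ∀ᵐ ω ∂μ, ξ l i ω ∈ Set.Icc (0 : ℝ) 1)
    (hξ_mean : ∀ l i, ∫ ω, ξ l i ω ∂μ = Phi hstar (n l))
    (hhat : Ω → ℝ)
    (L : Fin k → ℝ) (δ : ℝ)
    (hδ : 4 / Real.sqrt (2 * m * k) * max (24 * c₁ (cPrime L)) 29 < δ) :
    μ.real {ω | IsLeastSquares n M (xiHat fun l i => ξ l i ω) (hhat ω) ∧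
        δ < empNorm (fun l => Phi (hhat ω) (n l) - Phi hstar (n l))} ≤
      13 * Real.exp (-(m * k * δ ^ 2 / (16 * c₃))) := by
  have hk' : (0 : ℝ) < k := by exact_mod_cast hk
  have hm' : (0 : ℝ) < m := by exact_mod_cast hm
  obtain ⟨hδ0, hy⟩ := sample_size_mul_sq_gt hk hm hδ
  have hn' : ∀ l, (0 : ℝ) < n l := fun l => by exact_mod_cast hn l
  have hmono : MonotoneOn (fun h l => Phi h (n l)) (Set.Icc 0 M) :=
    fun x hx y hy hxy l => Phi_mono (hn' l) hx.1 hy.1 hxy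
  set W : Ω → Fin k → ℝ := fun ω l => xiHat (fun l i => ξ l i ω) l - Phi hstar (n l) with hW
  set ρ : ℕ → ℝ := fun j => k * δ ^ 2 * 4 ^ (j + 1) with hρ
  set shell : ℕ → Set Ω := fun j => {ω | ∑ l, W ω l ^ 2 ≤ k ∧ ∃ h ∈ Set.Icc 0 M,
    ∑ l, (Phi h (n l) - Phi hstar (n l)) ^ 2 ≤ ρ j ∧
      ρ j / 8 ≤ ∑ l, (Phi h (n l) - Phi hstar (n l)) * W ω l} with hshell
  -- The squared distance is at most k, so only shells with 4^j ≤ 1/δ² can be reached.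
  obtain ⟨J, hJ⟩ := pow_unbounded_of_one_lt (1 / δ ^ 2) (show (1 : ℝ) < 4 by norm_num)
  have hshell_le : ∀ j, μ.real (shell j) ≤
      40 * Real.exp (-(0.0072 * (m * k * δ ^ 2))) * (1 / 2) ^ j := by
    intro j
    have h4 : (1 : ℝ) ≤ 4 ^ j := one_le_pow₀ (by norm_num)
    have heq : 0.0018 * (m * ρ j) = 0.0072 * (m * k * δ ^ 2) * 4 ^ j := by
      simp only [hρ]
      ring
    have h3 : 3 ≤ 0.0072 * (m * k * δ ^ 2) := by linarith
    have hb := chaining_ordered_family (μ := μ) hmono (x₀ := hstar) (W := W) (m := m) (B := k)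
      (ρ := ρ j) (by positivity)
      (fun c v r hv hc => measure_linear_xiHat_le hm hξ_meas hξ_indep hξ_range hξ_mean c hv hc)
      (by rw [heq]; nlinarith)
    refine hb.trans ?_
    rw [heq, mul_assoc (40 : ℝ)]
    gcongr 40 * ?_
    refine le_trans ?_ (pow_mul_exp_le h3 j)
    refine le_trans ?_ (le_mul_of_one_le_left (Real.exp_pos _).le h4)
    refine Real.exp_le_exp.mpr (neg_le_neg ?_)
    gcongr
    norm_num
  have hcover : ∀ᵐ ω ∂μ, ω ∈ {ω | IsLeastSquares n M (xiHat fun l i => ξ l i ω) (hhat ω) ∧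
      δ < empNorm (fun l => Phi (hhat ω) (n l) - Phi hstar (n l))} →
      ω ∈ ⋃ j ∈ Finset.range J, shell j := by
    have hall : ∀ᵐ ω ∂μ, ∀ l i, ξ l i ω ∈ Set.Icc (0 : ℝ) 1 :=
      ae_all_iff.mpr fun l => ae_all_iff.mpr fun i => hξ_range l i
    filter_upwards [hall] with ω hω
    rintro ⟨hls, hfar⟩
    have hstar01 : ∀ l, Phi hstar (n l) ∈ Set.Icc (0 : ℝ) 1 :=
      fun l => Phi_mem_Icc hstar_mem.1 (hn' l)
    have hhat01 : ∀ l, Phi (hhat ω) (n l) ∈ Set.Icc (0 : ℝ) 1 :=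
      fun l => Phi_mem_Icc hls.1.1 (hn' l)
    have hbasic := hls.basic_inequality hk hstar_mem
    set E := ∑ l, (Phi (hhat ω) (n l) - Phi hstar (n l)) ^ 2 with hE
    have hEle : E ≤ k := sum_sq_sub_le_card hhat01 hstar01
    have hElt : k * δ ^ 2 < E := by
      rw [hE, ← empNorm_sq hk]
      gcongr
    have hkδ : 0 < k * δ ^ 2 := by positivity
    obtain ⟨j, hj1, hj2⟩ := exists_nat_pow_near (x := E / (k * δ ^ 2)) (y := (4 : ℝ))
      ((one_le_div hkδ).mpr hElt.le) (by norm_num)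
    rw [le_div_iff₀ hkδ] at hj1
    rw [div_lt_iff₀ hkδ] at hj2
    have hjJ : j < J := by
      have h1 : (4 : ℝ) ^ j ≤ 1 / δ ^ 2 := by
        rw [le_div_iff₀ (by positivity)]
        have : (4 ^ j * δ ^ 2) * k ≤ 1 * k := by linarith
        exact le_of_mul_le_mul_right this hk'
      exact (pow_lt_pow_iff_right₀ (by norm_num : (1 : ℝ) < 4)).mp (h1.trans_lt hJ)
    simp only [Set.mem_iUnion, Finset.mem_range]
    refine ⟨j, hjJ, sum_sq_sub_le_card (fun l => xiHat_mem_Icc hm hω l) hstar01,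
      hhat ω, hls.1, ?_, ?_⟩
    · simp only [hρ]
      linarith
    -- On shell j the squared distance is at least ρ_j/4, so the basic inequality forces an inner
    -- product of at least ρ_j/8.
    · have : ρ j / 8 = 4 ^ j * (k * δ ^ 2) / 2 := by
        simp only [hρ]
        ring
      rw [this]
      linarith
  calc _ ≤ μ.real (⋃ j ∈ Finset.range J, shell j) :=
        ENNReal.toReal_mono (measure_ne_top _ _) (measure_mono_ae hcover)
    _ ≤ ∑ j ∈ Finset.range J, μ.real (shell j) := measureReal_biUnion_finset_le _ _
    _ ≤ ∑ j ∈ Finset.range J, 40 * Real.exp (-(0.0072 * (m * k * δ ^ 2))) * (1 / 2) ^ j :=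
        Finset.sum_le_sum fun j _ => hshell_le j
    _ ≤ 80 * Real.exp (-(0.0072 * (m * k * δ ^ 2))) := by
        rw [← Finset.mul_sum]
        nlinarith [sum_geometric_two_le J, Real.exp_pos (-(0.0072 * (m * k * δ ^ 2)))]
    -- Since 16c₃ = 36864 and mkδ² > 6728, the exponent has room for an extra -3, and 80/8 = 10 ≤
    -- 13.
    _ ≤ 80 * Real.exp (-3 + -(m * k * δ ^ 2 / (16 * c₃))) := by
        gcongr
        rw [c₃]
        linarith
    _ ≤ 13 * Real.exp (-(m * k * δ ^ 2 / (16 * c₃))) := by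
        rw [Real.exp_add]
        nlinarith [exp_neg_three_le, Real.exp_pos (-(m * k * δ ^ 2 / (16 * c₃)))]
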